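/- **Setting.** Let $d\ge 1$, $T>0$, and let $\Omega\subset\mathbb R^d$ be a bounded domain (open and connected) satisfying the uniform interior and exterior cone conditions: there are $r_0>0$ and $\kappa\in(0,1)$ such that for every $x\in\partial\Omega$ there are unit vectors $\xi_e,\xi_i$ with $\{y\in B(x,r_0): \xi_e\cdot(y-x)>\kappa|y-x|\}\subset\Omega^{\mathsf c}$ and $\{y\in B(x,r_0): \xi_i\cdot(y-x)>\kappa|y-x|\}\subset\Omega$. Put $Q_T=(0,T)\times\Omega$. All spaces are real, and $D$ denotes the gradient in $x$. $W^{1,p}_0(\Omega)$ is the closure of $C_c^\infty(\Omega)$ for the norm $\|u\|_{L^p}+\|Du\|_{L^p}$; $W^{-1,p}(\Omega)$ is the dual of $W^{1,p'}_0(\Omega)$, $1/p+1/p'=1$; $W^{0,1}_p(Q_T)$ is the space of $u\in L^p(0,T;W^{1,p}_0(\Omega))$ with norm $\|u\|_{L^p(Q_T)}+\|Du\|_{L^p(Q_T)}$. Let $q>2(d+2)$ and $0<\eta<q-2(d+2)$ be such that $\frac{(q-\eta)(d+(q-\eta))}{d}>q$, and set $$X=W^{0,1}_q(Q_T)\times L^q(Q_T),\qquad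 Y_2=L^{q/2}(Q_T)\times L^{(q-\eta)/2}\bigl(0,T;W^{-1,(q-\eta)/2}(\Omega)\bigr).$$ **Assumptions.** 1. *Hamiltonian.* $H:\Omega\times\mathbb R^d\to\mathbb R$ is $C^2$ in its second variable $p$; $H$, its $p$-gradient $H_p$ and its $p$-Hessian $H_{pp}$ are jointly continuous on $\Omega\times\mathbb R^d$; and there is $C_H>0$ with $|H(x,p)|\le C_H(1+|p|^2)$, $|H_p(x,p)|\le C_H(1+|p|)$, $|H_{pp}(x,p)|\le C_H$ for all $(x,p)\in\Omega\times\mathbb R^d$. 2. *Coupling.* $F:L^2(Q_T)\to L^2(Q_T)$, and for every $p\in[2,\infty)$ there is $L_F>0$ with $\|F[m_1]-F[m_2]\|_{L^p}\le L_F\|m_1-m_2\|_{L^p}$ for all $m_1,m_2\in L^p(Q_T)$. 3. *Initial and terminal data.* $m_0$ is a probability density on $\Omega$ and belongs to $C^\alpha(\Omega)$ for some $\alpha\in(0,1)$, $u_T\in W^{2,\infty}(\Omega)$, and both vanish on $\partial\Omega$. 4. *$L^p$ shift property.* For every $1<p\le q/2$ there is $C_p>0$ with $\|u\|_{W^{2,p}}\le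 C_p(\|\Delta u\|_{L^p}+\|u\|_{L^p})$ for all $u\in W^{2,p}(\Omega)\cap W^{1,p}_0(\Omega)$. 5. *Differentiability of the coupling.* For all $1<r<p<\infty$ with $p\ge2$ (so that $F$ is defined on $L^p(Q_T)\subset L^2(Q_T)$), $F$ maps $L^p(Q_T)$ into $L^r(Q_T)$ and $F:L^p(Q_T)\to L^r(Q_T)$ is continuously differentiable. **Proposition.** The formula $$\mathcal R_2(v,\rho)=\begin{pmatrix}F[\rho]-H(\cdot,Dv)\\ \operatorname{div}\bigl(\rho\,H_p(\cdot,Dv)\bigr)\end{pmatrix}$$ defines a map $\mathcal R_2:X\to Y_2$. Here, for a vector field $G$ on $Q_T$, $\operatorname{div} G$ is given by $\langle \operatorname{div}G(t),\varphi\rangle=-\int_\Omega G(t,x)\cdot D\varphi(x)\,dx$ for a.e. $t$ and all $\varphi\in W_0^{1,r'}(\Omega)$, where $r=(q-\eta)/2$ and $1/r+1/r'=1$. For every $(u,m)\in X$, $\mathcal R_2$ is strictly differentiable at $(u,m)$: it is Fréchet differentiable there, and for every $\epsilon>0$ there is $\delta>0$ such that $$\|\mathcal R_2(x)-\mathcal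 R_2(y)-d\mathcal R_2[u,m](x-y)\|_{Y_2}\le\epsilon\|x-y\|_X\qquad\text{for all }x,y\in B_X((u,m),\delta).$$ Its differential is the bounded linear map $X\to Y_2$ given by $$d\mathcal R_2[u,m](v,\rho)=\begin{pmatrix}dF[m](\rho)-H_p(\cdot,Du)\cdot Dv\\ \operatorname{div}\bigl(\rho\,H_p(\cdot,Du)+m\,H_{pp}(\cdot,Du)Dv\bigr)\end{pmatrix},$$ where $dF[m]$ is the derivative at $m$ of $F:L^q(Q_T)\to L^{q/2}(Q_T)$. -/

import Mathlib

open MeasureTheory Set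
open scoped ENNReal NNReal ContDiff

noncomputable section

namespace MFG

/-- The space `ℝ^d` with its Euclidean norm. -/
abbrev Space (d : ℕ) : Type := EuclideanSpace ℝ (Fin d)

/-- Lebesgue measure on the time interval `(0,T)`. -/
abbrev timeMeasure (T : ℝ) : Measure ℝ := volume.restrict (Ioo 0 T)

/-- Lebesgue measure on `Ω`. -/
abbrev domMeasure {d : ℕ} (Ω : Set (Space d)) : Measure (Space d) := volume.restrict Ω

/-- Lebesgue measure on the cylinder `Q_T = (0,T) × Ω`. -/
abbrev cylMeasure {d : ℕ} (T : ℝ) (Ω : Set (Space d)) : Measure (ℝ × Space d) :=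
  (timeMeasure T).prod (domMeasure Ω)

/-! ### The domain -/

/-- Uniform interior and exterior cone conditions: at each boundary point `x` a truncated open cone
of fixed size and opening with vertex `x` lies in `Ωᶜ`, and another one lies in `Ω`. -/
def UniformConeConditions {d : ℕ} (Ω : Set (Space d)) : Prop :=
  ∃ r κ : ℝ, 0 < r ∧ 0 < κ ∧ κ < 1 ∧ ∀ x ∈ frontier Ω, ∃ ξe ξi : Space d,
    ‖ξe‖ = 1 ∧ ‖ξi‖ = 1 ∧
    {y | y ∈ Metric.ball x r ∧ κ * ‖y - x‖ < inner ℝ ξe (y - x)} ⊆ Ωᶜ ∧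
    {y | y ∈ Metric.ball x r ∧ κ * ‖y - x‖ < inner ℝ ξi (y - x)} ⊆ Ω

/-! ### Sobolev spaces on `Ω` -/

/-- `φ ∈ C_c^∞(Ω)`. -/
def IsTest {d : ℕ} (Ω : Set (Space d)) (φ : Space d → ℝ) : Prop :=
  ContDiff ℝ ∞ φ ∧ HasCompactSupport φ ∧ tsupport φ ⊆ Ω

/-- `g` is the weak gradient of `u` on `Ω` (for locally integrable `u` and `g`). -/
def IsWeakGradient {d : ℕ} (Ω : Set (Space d)) (u : Space d → ℝ) (g : Space d → Space d) : Prop :=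
  ∀ φ : Space d → ℝ, IsTest Ω φ → ∀ i : Fin d,
    ∫ x in Ω, u x * (gradient φ x) i = - ∫ x in Ω, g x i * φ x

theorem isTest_zero {d : ℕ} (Ω : Set (Space d)) : IsTest Ω (0 : Space d → ℝ) :=
  ⟨contDiff_const, HasCompactSupport.zero, by simp [tsupport]⟩

theorem IsTest.add {d : ℕ} {Ω : Set (Space d)} {φ ψ : Space d → ℝ}
    (hφ : IsTest Ω φ) (hψ : IsTest Ω ψ) : IsTest Ω (φ + ψ) :=
  ⟨hφ.1.add hψ.1, hφ.2.1.add hψ.2.1,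
    (tsupport_add φ ψ).trans (union_subset hφ.2.2 hψ.2.2)⟩

theorem IsTest.smul {d : ℕ} {Ω : Set (Space d)} {φ : Space d → ℝ}
    (c : ℝ) (hφ : IsTest Ω φ) : IsTest Ω (c • φ) :=
  ⟨contDiff_const.smul hφ.1, hφ.2.1.smul_left (f := fun _ => c),
    (tsupport_smul_subset_right (fun _ => c) φ).trans hφ.2.2⟩

theorem IsTest.differentiableAt {d : ℕ} {Ω : Set (Space d)} {φ : Space d → ℝ}
    (hφ : IsTest Ω φ) (x : Space d) : DifferentiableAt ℝ φ x :=
  (hφ.1.differentiable (by simp)).differentiableAt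

/-- Pairs (function, gradient) in `L^p × L^p`, with the norm `‖u‖_{L^p} + ‖Du‖_{L^p}`. -/
abbrev GradPair (d : ℕ) {α : Type*} [MeasurableSpace α] (p : ℝ≥0∞) (μ : Measure α) : Type _ :=
  WithLp 1 (Lp ℝ p μ × Lp (Space d) p μ)

/-- The pairs `(φ, Dφ)` with `φ ∈ C_c^∞(Ω)`, as a subspace of `L^p(Ω) × L^p(Ω; ℝ^d)`. -/
def testPairs {d : ℕ} (Ω : Set (Space d)) (p : ℝ≥0∞) [Fact (1 ≤ p)] :
    Submodule ℝ (GradPair d p (domMeasure Ω)) where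
  carrier := {w | ∃ φ : Space d → ℝ, IsTest Ω φ ∧
    w.fst =ᵐ[domMeasure Ω] φ ∧ w.snd =ᵐ[domMeasure Ω] gradient φ}
  zero_mem' := by
    refine ⟨0, isTest_zero Ω, ?_, ?_⟩
    · exact Lp.coeFn_zero _ _ _
    · filter_upwards [Lp.coeFn_zero (Space d) p (domMeasure Ω)] with x hx
      have : gradient (0 : Space d → ℝ) x = 0 := by
        simp [gradient, show (0 : Space d → ℝ) = fun _ => (0 : ℝ) from rfl]
      rw [this]
      exact hx
  add_mem' := by
    rintro a b ⟨φ, hφ, ha1, ha2⟩ ⟨ψ, hψ, hb1, hb2⟩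
    refine ⟨φ + ψ, hφ.add hψ, ?_, ?_⟩
    · filter_upwards [Lp.coeFn_add a.fst b.fst, ha1, hb1] with x h h1 h2
      have : (a + b).fst = a.fst + b.fst := rfl
      rw [this, h, Pi.add_apply, h1, h2, Pi.add_apply]
    · filter_upwards [Lp.coeFn_add a.snd b.snd, ha2, hb2] with x h h1 h2
      have : (a + b).snd = a.snd + b.snd := rfl
      rw [this, h, Pi.add_apply, h1, h2]
      simp only [gradient]
      rw [fderiv_add (hφ.differentiableAt x) (hψ.differentiableAt x), map_add]
  smul_mem' := by
    rintro c a ⟨φ, hφ, ha1, ha2⟩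
    refine ⟨c • φ, hφ.smul c, ?_, ?_⟩
    · filter_upwards [Lp.coeFn_smul c a.fst, ha1] with x h h1
      have : (c • a).fst = c • a.fst := rfl
      rw [this, h, Pi.smul_apply, h1, Pi.smul_apply]
    · filter_upwards [Lp.coeFn_smul c a.snd, ha2] with x h h1
      have : (c • a).snd = c • a.snd := rfl
      rw [this, h, Pi.smul_apply, h1]
      simp only [gradient]
      rw [fderiv_const_smul (hφ.differentiableAt x), map_smulₛₗ]
      simp

/-- `W^{1,p}_0(Ω)`, the closure of `C_c^∞(Ω)` in the norm `‖u‖_{L^p} + ‖Du‖_{L^p}`; an element `u`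
is stored as the pair `(u, Du)`. -/
def W10 {d : ℕ} (Ω : Set (Space d)) (p : ℝ≥0∞) [Fact (1 ≤ p)] :
    Submodule ℝ (GradPair d p (domMeasure Ω)) :=
  (testPairs Ω p).topologicalClosure

/-! ### Spaces on the cylinder -/

/-- `W^{0,1}_p(Q_T)`: functions `u` on `Q_T` with `u(t,·) ∈ W^{1,p}_0(Ω)` for a.e. `t`, with finite
norm `‖u‖_{L^p(Q_T)} + ‖Du‖_{L^p(Q_T)}`; an element `u` is stored as the pair `(u, Du)`, with `D` the
spatial gradient. -/
def W01 {d : ℕ} (T : ℝ) (Ω : Set (Space d)) (p : ℝ≥0∞) [Fact (1 ≤ p)] :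
    Submodule ℝ (GradPair d p (cylMeasure T Ω)) where
  carrier := {u | ∀ᵐ t ∂(timeMeasure T), ∃ w ∈ W10 Ω p,
    (∀ᵐ x ∂(domMeasure Ω), u.fst (t, x) = w.fst x) ∧
    (∀ᵐ x ∂(domMeasure Ω), u.snd (t, x) = w.snd x)}
  zero_mem' := by
    have h1 := Measure.ae_ae_of_ae_prod (Lp.coeFn_zero ℝ p (cylMeasure T Ω))
    have h2 := Measure.ae_ae_of_ae_prod (Lp.coeFn_zero (Space d) p (cylMeasure T Ω))
    filter_upwards [h1, h2] with t h1 h2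
    refine ⟨0, zero_mem _, ?_, ?_⟩
    · filter_upwards [h1, Lp.coeFn_zero ℝ p (domMeasure Ω)] with x hx hx'
      exact hx.trans hx'.symm
    · filter_upwards [h2, Lp.coeFn_zero (Space d) p (domMeasure Ω)] with x hx hx'
      exact hx.trans hx'.symm
  add_mem' := by
    intro a b ha hb
    have h1 := Measure.ae_ae_of_ae_prod (Lp.coeFn_add a.fst b.fst)
    have h2 := Measure.ae_ae_of_ae_prod (Lp.coeFn_add a.snd b.snd)
    filter_upwards [ha, hb, h1, h2] with t ⟨v, hv, hv1, hv2⟩ ⟨w, hw, hw1, hw2⟩ h1 h2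
    refine ⟨v + w, add_mem hv hw, ?_, ?_⟩
    · filter_upwards [h1, hv1, hw1, Lp.coeFn_add v.fst w.fst] with x hx e1 e2 hx'
      refine hx.trans (Eq.trans ?_ hx'.symm)
      rw [Pi.add_apply, Pi.add_apply, e1, e2]
    · filter_upwards [h2, hv2, hw2, Lp.coeFn_add v.snd w.snd] with x hx e1 e2 hx'
      refine hx.trans (Eq.trans ?_ hx'.symm)
      rw [Pi.add_apply, Pi.add_apply, e1, e2]
  smul_mem' := by
    intro c a ha
    have h1 := Measure.ae_ae_of_ae_prod (Lp.coeFn_smul c a.fst)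
    have h2 := Measure.ae_ae_of_ae_prod (Lp.coeFn_smul c a.snd)
    filter_upwards [ha, h1, h2] with t ⟨v, hv, hv1, hv2⟩ h1 h2
    refine ⟨c • v, Submodule.smul_mem _ c hv, ?_, ?_⟩
    · filter_upwards [h1, hv1, Lp.coeFn_smul c v.fst] with x hx e1 hx'
      refine hx.trans (Eq.trans ?_ hx'.symm)
      rw [Pi.smul_apply, Pi.smul_apply, e1]
    · filter_upwards [h2, hv2, Lp.coeFn_smul c v.snd] with x hx e1 hx'
      refine hx.trans (Eq.trans ?_ hx'.symm)
      rw [Pi.smul_apply, Pi.smul_apply, e1]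

/-- The exponents `q > 2(d+2)` and `0 < η < q - 2(d+2)` with `(q-η)(d+(q-η))/d > q`. -/
structure Exponents (d : ℕ) where
  q : ℝ
  η : ℝ
  hq : 2 * ((d : ℝ) + 2) < q
  hη : 0 < η
  hη_lt : η < q - 2 * ((d : ℝ) + 2)
  hqη : q < (q - η) * (d + (q - η)) / d

namespace Exponents

variable {d : ℕ} (P : Exponents d)

/-- The exponent `q`. -/
abbrev qExp : ℝ≥0∞ := ENNReal.ofReal P.q

/-- The exponent `q/2`. -/
abbrev qHalfExp : ℝ≥0∞ := ENNReal.ofReal (P.q / 2)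

/-- The exponent `r = (q-η)/2`. -/
abbrev rExp : ℝ≥0∞ := ENNReal.ofReal ((P.q - P.η) / 2)

/-- The exponent `r' = r/(r-1)` conjugate to `r = (q-η)/2`. -/
abbrev rConjExp : ℝ≥0∞ := ENNReal.ofReal (((P.q - P.η) / 2) / ((P.q - P.η) / 2 - 1))

instance : Fact (1 ≤ P.qExp) := ⟨by
  have := P.hq
  have hd : (0 : ℝ) ≤ d := Nat.cast_nonneg d
  exact ENNReal.one_le_ofReal.2 (by linarith)⟩

instance : Fact (1 ≤ P.qHalfExp) := ⟨by
  have := P.hq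
  have hd : (0 : ℝ) ≤ d := Nat.cast_nonneg d
  exact ENNReal.one_le_ofReal.2 (by linarith)⟩

instance : Fact (1 ≤ P.rExp) := ⟨by
  have := P.hη_lt
  have hd : (0 : ℝ) ≤ d := Nat.cast_nonneg d
  exact ENNReal.one_le_ofReal.2 (by linarith)⟩

instance : Fact (1 ≤ P.rConjExp) := ⟨by
  have := P.hη_lt
  have hd : (0 : ℝ) ≤ d := Nat.cast_nonneg d
  refine ENNReal.one_le_ofReal.2 ?_
  rw [le_div_iff₀ (by linarith)]
  linarith⟩

end Exponents

/-- `X = W^{0,1}_q(Q_T) × L^q(Q_T)`. -/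
abbrev X {d : ℕ} (T : ℝ) (Ω : Set (Space d)) (P : Exponents d) : Type _ :=
  W01 T Ω P.qExp × Lp ℝ P.qExp (cylMeasure T Ω)

/-- `W^{-1,r}(Ω)`, the dual of `W^{1,r'}_0(Ω)`, for `r = (q-η)/2`. -/
abbrev Wneg {d : ℕ} (Ω : Set (Space d)) (P : Exponents d) : Type _ :=
  StrongDual ℝ (W10 Ω P.rConjExp)

/-- `Y₂ = L^{q/2}(Q_T) × L^r(0,T; W^{-1,r}(Ω))`, `r = (q-η)/2`; the second factor is a Bochner
space. -/
abbrev Y₂ {d : ℕ} (T : ℝ) (Ω : Set (Space d)) (P : Exponents d) : Type _ :=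
  Lp ℝ P.qHalfExp (cylMeasure T Ω) × Lp (Wneg Ω P) P.rExp (timeMeasure T)

/-- The spatial gradient `Dv` of `v ∈ W^{0,1}_p(Q_T)`. -/
def W01.grad {d : ℕ} {T : ℝ} {Ω : Set (Space d)} {p : ℝ≥0∞} [Fact (1 ≤ p)] (v : W01 T Ω p) :
    Lp (Space d) p (cylMeasure T Ω) :=
  v.1.snd

/-! ### The data -/

/-- The gradient `H_p(x,p)` of `H` in its second variable. -/
def Hp {d : ℕ} (H : Space d → Space d → ℝ) (x p : Space d) : Space d :=
  gradient (H x) p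

/-- The Hessian `H_pp(x,p)` of `H` in its second variable, as a linear map. -/
def Hpp {d : ℕ} (H : Space d → Space d → ℝ) (x p : Space d) : Space d →L[ℝ] Space d :=
  fderiv ℝ (Hp H x) p

/-- The a.e. class in `L^r(μ)` of a function `f`, if `f` lies in `L^r(μ)` (and `0` otherwise). -/
def recast {α : Type*} [MeasurableSpace α] {μ : Measure α} (r : ℝ≥0∞) (f : α → ℝ) : Lp ℝ r μ :=
  open Classical in if h : MemLp f r μ then h.toLp f else 0

/-- `F[m]` for `m ∈ L^p(Q_T)`, `p ≥ 2`, where `F` acts on `L²(Q_T) ⊇ L^p(Q_T)`. -/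
def applyF {d : ℕ} {T : ℝ} {Ω : Set (Space d)}
    (F : Lp ℝ 2 (cylMeasure T Ω) → Lp ℝ 2 (cylMeasure T Ω)) {p : ℝ≥0∞}
    (m : Lp ℝ p (cylMeasure T Ω)) : Lp ℝ 2 (cylMeasure T Ω) :=
  F (recast 2 m)

/-- `F` as a map `L^p(Q_T) → L^r(Q_T)`. -/
def mapF {d : ℕ} {T : ℝ} {Ω : Set (Space d)}
    (F : Lp ℝ 2 (cylMeasure T Ω) → Lp ℝ 2 (cylMeasure T Ω)) (p r : ℝ≥0∞)
    (m : Lp ℝ p (cylMeasure T Ω)) : Lp ℝ r (cylMeasure T Ω) :=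
  recast r (applyF F m)

/-- Regularity and growth of the Hamiltonian on `Ω × ℝ^d`. -/
structure HamiltonianAssumption {d : ℕ} (Ω : Set (Space d)) (H : Space d → Space d → ℝ) :
    Prop where
  contDiff : ∀ x ∈ Ω, ContDiff ℝ 2 (H x)
  cont_H : ContinuousOn (fun z : Space d × Space d => H z.1 z.2) (Ω ×ˢ univ)
  cont_Hp : ContinuousOn (fun z : Space d × Space d => Hp H z.1 z.2) (Ω ×ˢ univ)
  cont_Hpp : ContinuousOn (fun z : Space d × Space d => Hpp H z.1 z.2) (Ω ×ˢ univ)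
  growth : ∃ C : ℝ, 0 < C ∧ ∀ x ∈ Ω, ∀ p : Space d,
    |H x p| ≤ C * (1 + ‖p‖ ^ 2) ∧ ‖Hp H x p‖ ≤ C * (1 + ‖p‖) ∧ ‖Hpp H x p‖ ≤ C

/-- `F` is Lipschitz in `L^p(Q_T)` for every `p ∈ [2,∞)`. -/
def CouplingLipschitz {d : ℕ} {T : ℝ} {Ω : Set (Space d)}
    (F : Lp ℝ 2 (cylMeasure T Ω) → Lp ℝ 2 (cylMeasure T Ω)) : Prop :=
  ∀ p : ℝ≥0∞, 2 ≤ p → p < ⊤ → ∃ L : ℝ, 0 < L ∧ ∀ m₁ m₂ : Lp ℝ 2 (cylMeasure T Ω),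
    MemLp m₁ p (cylMeasure T Ω) → MemLp m₂ p (cylMeasure T Ω) →
      eLpNorm (F m₁ - F m₂ : Lp ℝ 2 (cylMeasure T Ω)) p (cylMeasure T Ω) ≤
        ENNReal.ofReal L * eLpNorm (m₁ - m₂ : Lp ℝ 2 (cylMeasure T Ω)) p (cylMeasure T Ω)

/-- `m₀ ∈ C^α(Ω)` for some `α ∈ (0,1)`, `m₀` is a probability density on `Ω`, `m₀ = 0` on `∂Ω`. -/
def InitialAssumption {d : ℕ} (Ω : Set (Space d)) (m₀ : Space d → ℝ) : Prop :=
  (∃ α C : ℝ≥0, 0 < α ∧ α < 1 ∧ HolderOnWith C α m₀ (closure Ω)) ∧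
  (∀ x ∈ Ω, 0 ≤ m₀ x) ∧ ∫ x in Ω, m₀ x = 1 ∧ ∀ x ∈ frontier Ω, m₀ x = 0

/-- `u_T ∈ W^{2,∞}(Ω)` and `u_T = 0` on `∂Ω`. -/
def TerminalAssumption {d : ℕ} (Ω : Set (Space d)) (uT : Space d → ℝ) : Prop :=
  ContinuousOn uT (closure Ω) ∧ (∀ x ∈ frontier Ω, uT x = 0) ∧
  ∃ (g : Space d → Space d) (h : Fin d → Space d → Space d),
    MemLp uT ⊤ (domMeasure Ω) ∧ MemLp g ⊤ (domMeasure Ω) ∧ (∀ i, MemLp (h i) ⊤ (domMeasure Ω)) ∧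
    IsWeakGradient Ω uT g ∧ ∀ i, IsWeakGradient Ω (fun x => g x i) (h i)

/-- The assumptions on `H`, `F`, `m₀` and `u_T`. -/
structure DataAssumption {d : ℕ} (T : ℝ) (Ω : Set (Space d)) (H : Space d → Space d → ℝ)
    (F : Lp ℝ 2 (cylMeasure T Ω) → Lp ℝ 2 (cylMeasure T Ω)) (m₀ uT : Space d → ℝ) : Prop where
  hamiltonian : HamiltonianAssumption Ω H
  coupling : CouplingLipschitz F
  initial : InitialAssumption Ω m₀
  terminal : TerminalAssumption Ω uT

/-- The `L^p` shift property for `1 < p ≤ q/2`: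
`‖u‖_{W^{2,p}} ≤ C_p (‖Δu‖_{L^p} + ‖u‖_{L^p})` for `u ∈ W^{2,p}(Ω) ∩ W^{1,p}_0(Ω)`. Here `w = (u, Du)`
and `h i` is the weak gradient of the `i`-th partial derivative of `u`. -/
def ShiftProperty {d : ℕ} (Ω : Set (Space d)) (q : ℝ) : Prop :=
  ∀ (p : ℝ≥0∞) [Fact (1 ≤ p)], 1 < p → p ≤ ENNReal.ofReal (q / 2) →
    ∃ C : ℝ, 0 < C ∧ ∀ w ∈ W10 Ω p, ∀ h : Fin d → Lp (Space d) p (domMeasure Ω),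
      (∀ i, IsWeakGradient Ω (fun x => w.snd x i) (h i)) →
      ‖w.fst‖ + ‖w.snd‖ + ∑ i, ‖h i‖ ≤
        C * (‖∑ i, (EuclideanSpace.proj i : Space d →L[ℝ] ℝ).compLp (h i)‖ + ‖w.fst‖)

/-- `F : L^p(Q_T) → L^r(Q_T)` is (well defined and) continuously differentiable for
`1 < r < p < ⊤`. As `F` is given on `L²(Q_T)`, this is required only where `L^p ⊆ L²`, i.e. `2 ≤ p`. -/
def CouplingDifferentiable {d : ℕ} {T : ℝ} {Ω : Set (Space d)}
    (F : Lp ℝ 2 (cylMeasure T Ω) → Lp ℝ 2 (cylMeasure T Ω)) : Prop :=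
  ∀ (p r : ℝ≥0∞) [Fact (1 ≤ p)] [Fact (1 ≤ r)], 1 < r → r < p → 2 ≤ p → p < ⊤ →
    (∀ m : Lp ℝ p (cylMeasure T Ω), MemLp (applyF F m) r (cylMeasure T Ω)) ∧
    ContDiff ℝ 1 (mapF F p r)

/-! ### The nonlinear map -/

/-- `Λ ∈ L^r(0,T; W^{-1,r}(Ω))` is the spatial divergence of the vector field `G` on `Q_T`:
`⟨Λ(t), φ⟩ = -∫_Ω G(t,x) · Dφ(x) dx` for a.e. `t` and all `φ ∈ W^{1,r'}_0(Ω)`. -/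
def IsDiv {d : ℕ} {T : ℝ} {Ω : Set (Space d)} {P : Exponents d}
    (G : ℝ → Space d → Space d) (Λ : Lp (Wneg Ω P) P.rExp (timeMeasure T)) : Prop :=
  ∀ᵐ t ∂(timeMeasure T), ∀ φ : W10 Ω P.rConjExp,
    Integrable (fun x => inner ℝ (G t x) (φ.1.snd x)) (domMeasure Ω) ∧
    Λ t φ = - ∫ x in Ω, inner ℝ (G t x) (φ.1.snd x)

/-- `y = (F[ρ] - H(·,Dv), div(ρ H_p(·,Dv)))` in `Y₂`, for `z = (v,ρ) ∈ X`. This determines `y`. -/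
def IsR₂Value {d : ℕ} {T : ℝ} {Ω : Set (Space d)} {P : Exponents d}
    (H : Space d → Space d → ℝ) (F : Lp ℝ 2 (cylMeasure T Ω) → Lp ℝ 2 (cylMeasure T Ω))
    (z : X T Ω P) (y : Y₂ T Ω P) : Prop :=
  (∀ᵐ tx ∂(cylMeasure T Ω), y.1 tx = applyF F z.2 tx - H tx.2 (W01.grad z.1 tx)) ∧
  IsDiv (fun t x => z.2 (t, x) • Hp H x (W01.grad z.1 (t, x))) y.2

/-- `y = (dF[m]ρ - H_p(·,Du)·Dv, div(ρ H_p(·,Du) + m H_pp(·,Du)Dv))` in `Y₂`, for `a = (u,m) ∈ X` and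
`z = (v,ρ) ∈ X`, with `dF[m]` the Fréchet derivative at `m` of `F : L^q(Q_T) → L^{q/2}(Q_T)`. This
determines `y`. -/
def IsDR₂Value {d : ℕ} {T : ℝ} {Ω : Set (Space d)} {P : Exponents d}
    (H : Space d → Space d → ℝ) (F : Lp ℝ 2 (cylMeasure T Ω) → Lp ℝ 2 (cylMeasure T Ω))
    (a z : X T Ω P) (y : Y₂ T Ω P) : Prop :=
  (∀ᵐ tx ∂(cylMeasure T Ω), y.1 tx =
    fderiv ℝ (mapF F P.qExp P.qHalfExp) a.2 z.2 tx - inner ℝ (Hp H tx.2 (W01.grad a.1 tx)) (W01.grad z.1 tx)) ∧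
  IsDiv (fun t x => z.2 (t, x) • Hp H x (W01.grad a.1 (t, x)) +
    a.2 (t, x) • Hpp H x (W01.grad a.1 (t, x)) (W01.grad z.1 (t, x))) y.2

end MFG

end

/-! Only `Dv` and `ρ` enter the formula, so after the bounded linear map `(v, ρ) ↦ (Dv, ρ)` the
problem lives on Lebesgue spaces. There the map is built from superposition operators, a product and
a divergence, and the chain and product rules for strict derivatives apply.

The coupling is `C¹` from `L^q` to `L^{q/2}`, hence strictly differentiable. For `g ↦ H(·,g)` the
derivative `H_p` is Lipschitz in `p`, because `H_pp` is bounded. The linearization error of the pair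
`(f, g)` at `a` is then at most `C(|f-a|+|g-a|)|f-g|`, and Hölder bounds it in `L^{q/2}`
(`hasStrictFDerivAt_nemytskii_of_lipschitz`).

For `g ↦ H_p(·,g)` the derivative `H_pp` is only bounded and continuous, and an exponent must be
given up. The difference quotient of the error is bounded and tends to `0` a.e. along subsequences,
hence in `L^t` for finite `t`; this gives strict differentiability from `L^q` to `L^s` with `1/s =
1/t + 1/q` (`hasStrictFDerivAt_nemytskii_of_bounded`). Multiplication by `ρ ∈ L^q` lands in `L^r`
with `1/r = 1/t + 2/q`. Since `r = (q-η)/2 < q/2`, such a finite `t` exists: this is the role of `η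
> 0`.

Finally the divergence is bounded and linear from `L^r(Q_T)` to the Bochner space `L^r(0,T;
W^{-1,r})`. It is applied slice by slice, after `L^r(Q_T)` is mapped isometrically into `L^r(0,T;
L^r(Ω))` (`sliceL`). -/

noncomputable section

namespace MFG

open Filter Topology

/-! ### Fubini for Lebesgue spaces: functions on a product as Bochner functions of the first
variable. -/

section Slice

variable {α β E : Type*} [MeasurableSpace α] [MeasurableSpace β] {μ : Measure α} {ν : Measure β}
  [NormedAddCommGroup E] {p : ℝ≥0∞}

/-- In a second countable metric space, a function is measurable as soon as its distances to all
points are measurable. -/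
theorem measurable_of_edist {M : Type*} [PseudoEMetricSpace M] [SecondCountableTopology M]
    [MeasurableSpace M] [BorelSpace M] {f : α → M} (hf : ∀ c, Measurable fun t => edist (f t) c) :
    Measurable f := by
  refine measurable_of_isOpen fun U hU => ?_
  have hr : ∀ c : U, ∃ ε > 0, Metric.eball (c : M) ε ⊆ U := fun c => EMetric.isOpen_iff.1 hU c c.2
  choose ε hε hsub using hr
  -- Lindelöf: countably many of these balls already cover `U`, and the preimage of each ball is a
  -- sublevel set of a distance.
  obtain ⟨S, hS, hSU⟩ := TopologicalSpace.isOpen_iUnion_countable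
    (fun c : U => Metric.eball (c : M) (ε c)) fun c => Metric.isOpen_eball
  have hU' : U = ⋃ c ∈ S, Metric.eball (c : M) (ε c) := by
    rw [hSU]
    refine Subset.antisymm (fun x hx => mem_iUnion.2 ⟨⟨x, hx⟩, Metric.mem_eball_self (hε _)⟩)
      (iUnion_subset hsub)
  rw [hU', preimage_iUnion₂]
  exact MeasurableSet.biUnion hS fun c _ => measurableSet_lt (hf c) measurable_const

/-- The slice `G(t,·)` of `G ∈ L^p(μ × ν)`, as an element of `L^p(ν)`. -/
def slice (G : Lp E p (μ.prod ν)) (t : α) : Lp E p ν :=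
  open Classical in if h : MemLp (fun x => G (t, x)) p ν then h.toLp _ else 0

theorem stronglyMeasurable_slice_fun (G : Lp E p (μ.prod ν)) (t : α) :
    StronglyMeasurable fun x => G (t, x) :=
  (Lp.stronglyMeasurable G).comp_measurable measurable_prodMk_left

variable [SFinite ν]

/-- Tonelli for `|G|^p`. It gives both finiteness of almost every slice norm and the isometry
property of slicing. -/
theorem lintegral_slice_rpow [SFinite μ] (hp0 : p ≠ 0) (hp : p ≠ ⊤) (G : Lp E p (μ.prod ν)) :
    ∫⁻ t, eLpNorm (fun x => G (t, x)) p ν ^ p.toReal ∂μ =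
      eLpNorm G p (μ.prod ν) ^ p.toReal := by
  have h0 : 0 < p.toReal := ENNReal.toReal_pos hp0 hp
  simp_rw [eLpNorm_eq_lintegral_rpow_enorm_toReal hp0 hp, ← ENNReal.rpow_mul,
    one_div_mul_cancel h0.ne', ENNReal.rpow_one]
  rw [lintegral_prod]
  exact (((Lp.stronglyMeasurable G).enorm.pow_const _)).aemeasurable

/-- These are the distances from the slices to a fixed `c`, which `measurable_of_edist` needs; they
are measurable as powers of partial integrals. -/
theorem measurable_eLpNorm_slice_sub (hp0 : p ≠ 0) (hp : p ≠ ⊤) (G : Lp E p (μ.prod ν))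
    {c : β → E} (hc : StronglyMeasurable c) :
    Measurable fun t => eLpNorm (fun x => G (t, x) - c x) p ν := by
  simp_rw [eLpNorm_eq_lintegral_rpow_enorm_toReal hp0 hp]
  refine Measurable.pow_const (Measurable.lintegral_prod_right' (f := fun z : α × β =>
    ‖G z - c z.2‖ₑ ^ p.toReal) ?_) _
  exact ((Lp.stronglyMeasurable G).sub (hc.comp_measurable measurable_snd)).enorm.pow_const _

theorem measurable_eLpNorm_slice (hp0 : p ≠ 0) (hp : p ≠ ⊤) (G : Lp E p (μ.prod ν)) :
    Measurable fun t => eLpNorm (fun x => G (t, x)) p ν := by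
  simpa using measurable_eLpNorm_slice_sub hp0 hp G (c := 0) stronglyMeasurable_zero

theorem ae_memLp_slice [SFinite μ] (hp0 : p ≠ 0) (hp : p ≠ ⊤) (G : Lp E p (μ.prod ν)) :
    ∀ᵐ t ∂μ, MemLp (fun x => G (t, x)) p ν := by
  have h0 : 0 < p.toReal := ENNReal.toReal_pos hp0 hp
  have h : ∀ᵐ t ∂μ, eLpNorm (fun x => G (t, x)) p ν ^ p.toReal < ⊤ := by
    refine ae_lt_top ((measurable_eLpNorm_slice hp0 hp G).pow_const _) ?_
    rw [lintegral_slice_rpow hp0 hp G]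
    exact (ENNReal.rpow_lt_top_of_nonneg h0.le (Lp.eLpNorm_ne_top G)).ne
  filter_upwards [h] with t ht
  exact ⟨(stronglyMeasurable_slice_fun G t).aestronglyMeasurable,
    (ENNReal.rpow_lt_top_iff_of_pos h0).1 ht⟩

theorem coeFn_slice [SFinite μ] (hp0 : p ≠ 0) (hp : p ≠ ⊤) (G : Lp E p (μ.prod ν)) :
    ∀ᵐ t ∂μ, slice G t =ᵐ[ν] fun x => G (t, x) := by
  filter_upwards [ae_memLp_slice hp0 hp G] with t ht
  rw [slice, dif_pos ht]
  exact ht.coeFn_toLp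

theorem stronglyMeasurable_slice [Fact (1 ≤ p)] [SecondCountableTopology (Lp E p ν)] (hp : p ≠ ⊤)
    (G : Lp E p (μ.prod ν)) : StronglyMeasurable (slice G) := by
  have hp0 : p ≠ 0 := (zero_lt_one.trans_le (Fact.out : 1 ≤ p)).ne'
  borelize ↥(Lp E p ν)
  refine (measurable_of_edist fun c => ?_).stronglyMeasurable
  -- Where the slice norm is infinite, `slice` takes its default value `0`, so the distance is
  -- constant there.
  have h : (fun t => edist (slice G t) c) = fun t => open Classical in
      if eLpNorm (fun x => G (t, x)) p ν < ⊤ then eLpNorm (fun x => G (t, x) - c x) p ν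
      else edist 0 c := by
    funext t
    by_cases ht : eLpNorm (fun x => G (t, x)) p ν < ⊤
    · have hm : MemLp (fun x => G (t, x)) p ν :=
        ⟨(stronglyMeasurable_slice_fun G t).aestronglyMeasurable, ht⟩
      rw [if_pos ht, slice, dif_pos hm, Lp.edist_def]
      refine eLpNorm_congr_ae ?_
      filter_upwards [hm.coeFn_toLp] with x hx
      simp [hx]
    · rw [if_neg ht, slice, dif_neg fun hm => ht hm.2]
  rw [h]
  exact Measurable.ite (measurableSet_lt (measurable_eLpNorm_slice hp0 hp G) measurable_const)
    (measurable_eLpNorm_slice_sub hp0 hp G (Lp.stronglyMeasurable c)) measurable_const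

theorem eLpNorm_slice [SFinite μ] [Fact (1 ≤ p)] (hp : p ≠ ⊤) (G : Lp E p (μ.prod ν)) :
    eLpNorm (slice G) p μ = eLpNorm G p (μ.prod ν) := by
  have hp0 : p ≠ 0 := (zero_lt_one.trans_le (Fact.out : 1 ≤ p)).ne'
  have h0 : 0 < p.toReal := ENNReal.toReal_pos hp0 hp
  rw [eLpNorm_eq_lintegral_rpow_enorm_toReal hp0 hp,
    lintegral_congr_ae (g := fun t => eLpNorm (fun x => G (t, x)) p ν ^ p.toReal),
    lintegral_slice_rpow hp0 hp, ← ENNReal.rpow_mul, mul_one_div_cancel h0.ne', ENNReal.rpow_one]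
  filter_upwards [coeFn_slice hp0 hp G] with t ht
  rw [Lp.enorm_def, eLpNorm_congr_ae ht]

variable (E p μ ν) in
/-- `G ↦ (t ↦ G(t,·))` as a bounded linear map `L^p(μ × ν; E) → L^p(μ; L^p(ν; E))`. -/
def sliceL [SFinite μ] [NormedSpace ℝ E] [Fact (1 ≤ p)] [SecondCountableTopology (Lp E p ν)]
    (hp : p ≠ ⊤) : Lp E p (μ.prod ν) →L[ℝ] Lp (Lp E p ν) p μ :=
  have hm (G : Lp E p (μ.prod ν)) : MemLp (slice G) p μ :=
    ⟨(stronglyMeasurable_slice hp G).aestronglyMeasurable,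
      (eLpNorm_slice hp G).trans_lt (Lp.eLpNorm_lt_top G)⟩
  have hp0 : p ≠ 0 := (zero_lt_one.trans_le (Fact.out : 1 ≤ p)).ne'
  LinearMap.mkContinuous
    { toFun G := (hm G).toLp
      map_add' G K := by
        rw [← MemLp.toLp_add, MemLp.toLp_eq_toLp_iff]
        filter_upwards [coeFn_slice hp0 hp G, coeFn_slice hp0 hp K, coeFn_slice hp0 hp (G + K),
          Measure.ae_ae_of_ae_prod (Lp.coeFn_add G K)] with t h1 h2 h3 h4
        refine Lp.ext ?_
        rw [Pi.add_apply]
        filter_upwards [h1, h2, h3, h4, Lp.coeFn_add (slice G t) (slice K t)] with x h1 h2 h3 h4 h5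
        rw [h3, h5, h4, Pi.add_apply, Pi.add_apply, h1, h2]
      map_smul' c G := by
        rw [RingHom.id_apply, ← MemLp.toLp_const_smul, MemLp.toLp_eq_toLp_iff]
        filter_upwards [coeFn_slice hp0 hp G, coeFn_slice hp0 hp (c • G),
          Measure.ae_ae_of_ae_prod (Lp.coeFn_smul c G)] with t h1 h3 h4
        refine Lp.ext ?_
        rw [Pi.smul_apply]
        filter_upwards [h1, h3, h4, Lp.coeFn_smul c (slice G t)] with x h1 h3 h4 h5
        rw [h3, h5, h4, Pi.smul_apply, Pi.smul_apply, h1] } 1 fun G => by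
    simp [Lp.norm_def, eLpNorm_congr_ae (hm G).coeFn_toLp, eLpNorm_slice hp G]

theorem coeFn_sliceL [SFinite μ] [NormedSpace ℝ E] [Fact (1 ≤ p)]
    [SecondCountableTopology (Lp E p ν)] (hp : p ≠ ⊤) (G : Lp E p (μ.prod ν)) :
    ∀ᵐ t ∂μ, sliceL E μ ν p hp G t =ᵐ[ν] fun x => G (t, x) := by
  have hp0 : p ≠ 0 := (zero_lt_one.trans_le (Fact.out : 1 ≤ p)).ne'
  have hm : MemLp (slice G) p μ :=
    ⟨(stronglyMeasurable_slice hp G).aestronglyMeasurable,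
      (eLpNorm_slice hp G).trans_lt (Lp.eLpNorm_lt_top G)⟩
  filter_upwards [coeFn_slice hp0 hp G, hm.coeFn_toLp] with t h1 h2
  have h3 : sliceL E μ ν p hp G t = slice G t := h2
  rw [h3]
  exact h1

/-- Slicewise application of a bounded linear map `L : L^p(ν; E) → W`, as a bounded linear map
`L^p(μ × ν; E) → L^p(μ; W)`. -/
def compSliceL [SFinite μ] [NormedSpace ℝ E] [Fact (1 ≤ p)] [SecondCountableTopology (Lp E p ν)]
    {W : Type*} [NormedAddCommGroup W] [NormedSpace ℝ W] (hp : p ≠ ⊤) (L : Lp E p ν →L[ℝ] W) :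
    Lp E p (μ.prod ν) →L[ℝ] Lp W p μ :=
  (L.compLpL p μ).comp (sliceL E μ ν p hp)

theorem coeFn_compSliceL [SFinite μ] [NormedSpace ℝ E] [Fact (1 ≤ p)]
    [SecondCountableTopology (Lp E p ν)] {W : Type*} [NormedAddCommGroup W] [NormedSpace ℝ W]
    (hp : p ≠ ⊤) (L : Lp E p ν →L[ℝ] W) (G : Lp E p (μ.prod ν)) :
    ∀ᵐ t ∂μ, ∃ f : Lp E p ν, f =ᵐ[ν] (fun x => G (t, x)) ∧ compSliceL hp L G t = L f := by
  filter_upwards [coeFn_sliceL hp G, L.coeFn_compLpL (sliceL E μ ν p hp G)] with t h1 h2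
  exact ⟨_, h1, h2⟩

end Slice

theorem exists_subseq_tendsto_ae {α E : Type*} [MeasurableSpace α] {μ : Measure α}
    [NormedAddCommGroup E] {p : ℝ≥0∞} [Fact (1 ≤ p)] {ns : ℕ → Lp E p μ} {a : Lp E p μ}
    (h : Tendsto ns atTop (𝓝 a)) : ∃ ms : ℕ → ℕ, StrictMono ms ∧
      ∀ᵐ x ∂μ, Tendsto (fun n => ns (ms n) x) atTop (𝓝 (a x)) :=
  (tendstoInMeasure_of_tendsto_Lp h).exists_seq_tendsto_ae

/-! ### Strict differentiability of superposition operators between Lebesgue spaces. -/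

section Nemytskii

variable {α E F : Type*} [MeasurableSpace α] {μ : Measure α}
  [NormedAddCommGroup E] [NormedSpace ℝ E] [NormedAddCommGroup F] [NormedSpace ℝ F]
  {p s t : ℝ≥0∞} [Fact (1 ≤ p)] [Fact (1 ≤ s)]

/-- Strict differentiability of an operator between Lebesgue spaces whose linearization error is
pointwise at most `θ(f,g)|f - g|`, with `θ(f,g) → 0` in `L^t`, `1/s = 1/t + 1/p`. -/
theorem hasStrictFDerivAt_of_pointwise [t.HolderTriple p s] {N : Lp E p μ → Lp F s μ}
    {A : Lp E p μ →L[ℝ] Lp F s μ} {a : Lp E p μ} {θ : Lp E p μ → Lp E p μ → α → ℝ}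
    (hθm : ∀ f g, AEStronglyMeasurable (θ f g) μ)
    (hθ : ∀ f g, ∀ᵐ x ∂μ, ‖(N f - N g - A (f - g)) x‖ ≤ ‖θ f g x‖ * ‖(f - g) x‖)
    (hlim : Tendsto (fun z : Lp E p μ × Lp E p μ => eLpNorm (θ z.1 z.2) t μ) (𝓝 (a, a)) (𝓝 0)) :
    HasStrictFDerivAt N A a := by
  rw [hasStrictFDerivAt_iff_isLittleO, Asymptotics.isLittleO_iff]
  intro ε hε
  filter_upwards [hlim.eventually_le_const (ENNReal.ofReal_pos.2 hε)] with z hz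
  have h1 : eLpNorm (N z.1 - N z.2 - A (z.1 - z.2) : Lp F s μ) s μ ≤
      eLpNorm (θ z.1 z.2) t μ * eLpNorm (z.1 - z.2 : Lp E p μ) p μ := by
    have h2 := eLpNorm_le_eLpNorm_mul_eLpNorm'_of_norm (p := t) (q := p) (r := s) (hθm z.1 z.2)
      (Lp.aestronglyMeasurable (z.1 - z.2)) (fun a b => ‖a‖ * ‖b‖) 1
      (Eventually.of_forall fun x => by simp)
    rw [ENNReal.coe_one, one_mul] at h2
    refine (eLpNorm_mono_ae ?_).trans h2
    filter_upwards [hθ z.1 z.2] with x hx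
    simpa using hx
  have h3 : ‖N z.1 - N z.2 - A (z.1 - z.2)‖ₑ ≤ ENNReal.ofReal ε * ‖z.1 - z.2‖ₑ := by
    simp only [Lp.enorm_def]
    exact h1.trans (by gcongr)
  rw [← ofReal_norm, ← ofReal_norm, ← ENNReal.ofReal_mul hε.le] at h3
  exact (ENNReal.ofReal_le_ofReal_iff (by positivity)).1 h3

/-- Dominated convergence along subsequences. The constant bound is integrable to the power `t`
because the measure is finite and `t < ∞`; a countably generated filter makes sequences sufficient.
-/
theorem tendsto_eLpNorm_of_subseq_bounded [IsFiniteMeasure μ] (ht : 1 ≤ t) (ht' : t ≠ ⊤)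
    {Z : Type*} {l : Filter Z} [l.IsCountablyGenerated] {θ : Z → α → ℝ} {C : ℝ}
    (hθm : ∀ z, AEStronglyMeasurable (θ z) μ) (hC : ∀ z, ∀ᵐ x ∂μ, ‖θ z x‖ ≤ C)
    (hlim : ∀ ns : ℕ → Z, Tendsto ns atTop l → ∃ ms : ℕ → ℕ,
      ∀ᵐ x ∂μ, Tendsto (fun n => θ (ns (ms n)) x) atTop (𝓝 0)) :
    Tendsto (fun z => eLpNorm (θ z) t μ) l (𝓝 0) := by
  refine tendsto_of_subseq_tendsto fun ns hns => ?_
  obtain ⟨ms, hms⟩ := hlim ns hns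
  refine ⟨ms, ?_⟩
  have h0 : 0 < t.toReal := ENNReal.toReal_pos (zero_lt_one.trans_le ht).ne' ht'
  have h1 : Tendsto (fun n => ∫⁻ x, ‖θ (ns (ms n)) x‖ₑ ^ t.toReal ∂μ) atTop (𝓝 0) := by
    have := tendsto_lintegral_of_dominated_convergence' (μ := μ)
      (F := fun n x => ‖θ (ns (ms n)) x‖ₑ ^ t.toReal) (f := fun _ => 0)
      (fun _ => ENNReal.ofReal C ^ t.toReal) (fun n => ((hθm _).enorm.pow_const _))
      (fun n => ?_) ?_ ?_
    · simpa using this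
    · filter_upwards [hC (ns (ms n))] with x hx
      gcongr
      rw [← ofReal_norm]
      exact ENNReal.ofReal_le_ofReal hx
    · rw [lintegral_const]
      exact ENNReal.mul_ne_top (ENNReal.rpow_ne_top_of_nonneg h0.le ENNReal.ofReal_ne_top)
        (measure_ne_top _ _)
    · filter_upwards [hms] with x hx
      have h2 : Tendsto (fun n => ‖θ (ns (ms n)) x‖ₑ) atTop (𝓝 0) := by
        simpa using hx.enorm
      have := (ENNReal.continuous_rpow_const (y := t.toReal)).tendsto 0
      rw [ENNReal.zero_rpow_of_pos h0] at this
      exact this.comp h2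
  simp_rw [eLpNorm_eq_lintegral_rpow_enorm_toReal (zero_lt_one.trans_le ht).ne' ht']
  have := (ENNReal.continuous_rpow_const (y := 1 / t.toReal)).tendsto 0
  rw [ENNReal.zero_rpow_of_pos (by positivity)] at this
  exact this.comp h1

/-- A Nemytskii operator `f ↦ k(·, f)` with bounded derivative is strictly differentiable from `L^p`
to `L^s`, `1/s = 1/t + 1/p`, `t < ∞`. -/
theorem hasStrictFDerivAt_nemytskii_of_bounded [IsFiniteMeasure μ] [t.HolderTriple p s]
    (ht : 1 ≤ t) (ht' : t ≠ ⊤) {N : Lp E p μ → Lp F s μ} {A : Lp E p μ →L[ℝ] Lp F s μ}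
    {a : Lp E p μ} {k : α → E → F} {k' : α → E → E →L[ℝ] F} {C : ℝ}
    (hN : ∀ f : Lp E p μ, ∀ᵐ x ∂μ, N f x = k x (f x))
    (hA : ∀ f : Lp E p μ, ∀ᵐ x ∂μ, A f x = k' x (a x) (f x))
    (hC : ∀ᵐ x ∂μ, ∀ e, ‖k' x e‖ ≤ C)
    (hk : ∀ᵐ x ∂μ, ∀ e, HasStrictFDerivAt (k x) (k' x e) e) :
    HasStrictFDerivAt N A a := by
  set R : Lp E p μ × Lp E p μ → Lp F s μ := fun z => N z.1 - N z.2 - A (z.1 - z.2) with hR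
  have hRx (z : Lp E p μ × Lp E p μ) : ∀ᵐ x ∂μ,
      R z x = k x (z.1 x) - k x (z.2 x) - k' x (a x) (z.1 x - z.2 x) ∧
      (z.1 - z.2) x = z.1 x - z.2 x := by
    filter_upwards [hN z.1, hN z.2, hA (z.1 - z.2), Lp.coeFn_sub (N z.1) (N z.2),
      Lp.coeFn_sub (N z.1 - N z.2) (A (z.1 - z.2)), Lp.coeFn_sub z.1 z.2] with x h1 h2 h3 h4 h5 h6
    rw [hR]
    refine ⟨?_, by rw [h6, Pi.sub_apply]⟩
    rw [h5, Pi.sub_apply, h4, Pi.sub_apply, h1, h2, h3, h6, Pi.sub_apply]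
  -- One `C` comes from the mean value inequality for `k x`, the other from the linear term.
  have hRle (z : Lp E p μ × Lp E p μ) : ∀ᵐ x ∂μ, ‖R z x‖ ≤ 2 * C * ‖(z.1 - z.2) x‖ := by
    filter_upwards [hRx z, hC, hk] with x hx hC hk
    rw [hx.1, hx.2]
    have h1 := Convex.norm_image_sub_le_of_norm_hasFDerivWithin_le (𝕜 := ℝ) (f := k x)
      (fun e _ => (hk e).hasFDerivAt.hasFDerivWithinAt) (fun e _ => hC e) convex_univ
      (mem_univ (z.2 x)) (mem_univ (z.1 x))
    have h2 := (k' x (a x)).le_of_opNorm_le (hC _) (z.1 x - z.2 x)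
    linarith [norm_sub_le (k x (z.1 x) - k x (z.2 x)) (k' x (a x) (z.1 x - z.2 x))]
  -- The weight is the difference quotient of the remainder. Where `f = g` it is `0` by the
  -- convention on division, and `hRle` shows that the remainder vanishes there too.
  refine hasStrictFDerivAt_of_pointwise (t := t)
    (θ := fun f g x => ‖R (f, g) x‖ / ‖(f - g) x‖) (fun f g =>
      (Lp.aestronglyMeasurable _).norm.div₀ (Lp.aestronglyMeasurable _).norm) (fun f g => ?_) ?_
  · filter_upwards [hRle (f, g)] with x hx
    rcases eq_or_ne ‖(f - g) x‖ 0 with h | h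
    · rw [h, mul_zero] at hx ⊢
      exact hx
    · rw [norm_div, norm_norm, norm_norm, div_mul_cancel₀ _ h]
  -- The maximum with `0` covers the points where the quotient is `0`, since no sign of `C` is
  -- assumed.
  · refine tendsto_eLpNorm_of_subseq_bounded ht ht' (C := 2 * C ⊔ 0) (fun z =>
      (Lp.aestronglyMeasurable _).norm.div₀ (Lp.aestronglyMeasurable _).norm) (fun z => ?_)
      fun ns hns => ?_
    · filter_upwards [hRle z] with x hx
      rw [norm_div, norm_norm, norm_norm]
      rcases eq_or_ne ‖(z.1 - z.2) x‖ 0 with h | h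
      · rw [h, div_zero]
        exact le_max_right _ _
      · exact le_max_of_le_left ((div_le_iff₀ (by positivity)).2 hx)
    -- Two successive extractions give a.e. convergence of both components to `a`; strict
    -- differentiability of `k x` at `a x` then sends the quotient to `0`.
    · have hns' := nhds_prod_eq (x := a) (y := a) ▸ hns
      obtain ⟨ms, hms, h1⟩ := exists_subseq_tendsto_ae (tendsto_fst.comp hns')
      obtain ⟨ks, hks, h2⟩ := exists_subseq_tendsto_ae
        ((tendsto_snd.comp hns').comp hms.tendsto_atTop)
      refine ⟨ms ∘ ks, ?_⟩
      filter_upwards [h1, h2, ae_all_iff.2 fun n => hRx (ns (ms (ks n))), hk] with x h1 h2 h3 hk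
      have h4 := (hasStrictFDerivAt_iff_isLittleO.1 (hk (a x))).comp_tendsto
        ((h1.comp hks.tendsto_atTop).prodMk_nhds h2)
      refine h4.norm_norm.tendsto_div_nhds_zero.congr fun n => ?_
      simp only [Function.comp_apply]
      rw [(h3 n).2, (h3 n).1]

/-- A Nemytskii operator `f ↦ k(·, f)` whose derivative is Lipschitz is strictly differentiable from
`L^p` to `L^{p/2}`. -/
theorem hasStrictFDerivAt_nemytskii_of_lipschitz [p.HolderTriple p s]
    {N : Lp E p μ → Lp F s μ} {A : Lp E p μ →L[ℝ] Lp F s μ}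
    {a : Lp E p μ} {k : α → E → F} {k' : α → E → E →L[ℝ] F} {C : ℝ}
    (hN : ∀ f : Lp E p μ, ∀ᵐ x ∂μ, N f x = k x (f x))
    (hA : ∀ f : Lp E p μ, ∀ᵐ x ∂μ, A f x = k' x (a x) (f x))
    (hC : ∀ᵐ x ∂μ, ∀ e e', ‖k' x e - k' x e'‖ ≤ C * ‖e - e'‖)
    (hk : ∀ᵐ x ∂μ, ∀ e, HasFDerivAt (k x) (k' x e) e) :
    HasStrictFDerivAt N A a := by
  refine hasStrictFDerivAt_of_pointwise (t := p)
    (θ := fun f g x => C * (‖(f - a) x‖ + ‖(g - a) x‖)) (fun f g => ?_) (fun f g => ?_) ?_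
  · exact ((Lp.aestronglyMeasurable _).norm.add (Lp.aestronglyMeasurable _).norm).const_mul C
  · filter_upwards [hN f, hN g, hA (f - g), Lp.coeFn_sub (N f) (N g),
      Lp.coeFn_sub (N f - N g) (A (f - g)), Lp.coeFn_sub f g, Lp.coeFn_sub f a, Lp.coeFn_sub g a,
      hC, hk] with x h1 h2 h3 h4 h5 h6 h7 h8 hC hk
    rw [h5, Pi.sub_apply, h4, Pi.sub_apply, h1, h2, h3, h6, h7, h8]
    simp only [Pi.sub_apply]
    -- A negative Lipschitz constant forces `f x = g x`, and both sides vanish.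
    rcases lt_or_ge C 0 with hC0 | hC0
    · have h0 : ‖f x - g x‖ = 0 := by
        have := (norm_nonneg _).trans (hC (f x) (g x))
        nlinarith [norm_nonneg (f x - g x)]
      rw [norm_sub_eq_zero_iff.1 h0]
      simp
    · rw [Real.norm_of_nonneg (by positivity)]
      refine Convex.norm_image_sub_le_of_norm_hasFDerivWithin_le' (𝕜 := ℝ) (f := k x)
        (s := segment ℝ (g x) (f x)) (f' := k' x)
        (fun e _ => (hk e).hasFDerivWithinAt) (fun e he => (hC _ _).trans ?_)
        (convex_segment _ _) (left_mem_segment ℝ _ _) (right_mem_segment ℝ _ _)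
      gcongr
      -- Both endpoints lie in this ball around `a x`, hence by convexity so does the segment.
      have h9 : e ∈ Metric.closedBall (a x) (‖f x - a x‖ + ‖g x - a x‖) :=
        (convex_closedBall _ _).segment_subset (by simp [dist_eq_norm]) (by simp [dist_eq_norm]) he
      simpa [dist_eq_norm] using h9
  · have hb (z : Lp E p μ × Lp E p μ) :
        eLpNorm (fun x => C * (‖(z.1 - a) x‖ + ‖(z.2 - a) x‖)) p μ ≤
          ‖C‖ₑ * (‖z.1 - a‖ₑ + ‖z.2 - a‖ₑ) := by
      have h1 := eLpNorm_const_smul_le (c := C) (f := fun x => ‖(z.1 - a) x‖ + ‖(z.2 - a) x‖)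
        (p := p) (μ := μ)
      refine h1.trans ?_
      gcongr
      refine (eLpNorm_add_le (Lp.aestronglyMeasurable (z.1 - a)).norm
        (Lp.aestronglyMeasurable (z.2 - a)).norm Fact.out).trans ?_
      rw [eLpNorm_norm, eLpNorm_norm, Lp.enorm_def, Lp.enorm_def]
    refine tendsto_of_tendsto_of_tendsto_of_le_of_le tendsto_const_nhds ?_ (fun _ => zero_le) hb
    have h2 : Continuous fun z : Lp E p μ × Lp E p μ => ‖z.1 - a‖ₑ + ‖z.2 - a‖ₑ := by fun_prop
    have h3 := ENNReal.Tendsto.const_mul (a := ‖C‖ₑ) (h2.tendsto (a, a)) (Or.inr enorm_ne_top)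
    simpa using h3

end Nemytskii

/-! ### Exponents -/

theorem holderTriple_ofReal {a b c : ℝ} (ha : 0 < a) (hb : 0 < b) (hc : 0 < c)
    (h : a⁻¹ + b⁻¹ = c⁻¹) :
    ENNReal.HolderTriple (ENNReal.ofReal a) (ENNReal.ofReal b) (ENNReal.ofReal c) where
  inv_add_inv_eq_inv := by
    rw [← ENNReal.ofReal_inv_of_pos ha, ← ENNReal.ofReal_inv_of_pos hb,
      ← ENNReal.ofReal_inv_of_pos hc, ← ENNReal.ofReal_add (by positivity) (by positivity), h]

namespace Exponents

variable {d : ℕ} (P : Exponents d)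

theorem four_lt_q : 4 < P.q := by
  have := P.hq
  have hd : (0 : ℝ) ≤ d := Nat.cast_nonneg d
  linarith

theorem one_lt_r : 1 < (P.q - P.η) / 2 := by
  have := P.hη_lt
  have hd : (0 : ℝ) ≤ d := Nat.cast_nonneg d
  linarith

/-- This is `r < q/2`, the strict gap provided by `η > 0`. It makes `1/t = 1/r - 2/q` positive, so
that `t` is finite. -/
theorem two_div_q_lt : 2 * P.q⁻¹ < ((P.q - P.η) / 2)⁻¹ := by
  have h1 := P.four_lt_q
  have h2 := P.one_lt_r
  have h3 : (P.q / 2)⁻¹ < ((P.q - P.η) / 2)⁻¹ :=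
    inv_strictAnti₀ (by linarith) (by linarith [P.hη])
  rwa [inv_div, div_eq_mul_inv] at h3

theorem inv_r_lt_one : ((P.q - P.η) / 2)⁻¹ < 1 := inv_lt_one_of_one_lt₀ P.one_lt_r

theorem inv_q_pos : 0 < P.q⁻¹ := inv_pos.2 (by linarith [P.four_lt_q])

/-- The exponent `s` with `1/q + 1/s = 1/r`. -/
abbrev sExp : ℝ≥0∞ := ENNReal.ofReal (((P.q - P.η) / 2)⁻¹ - P.q⁻¹)⁻¹

/-- The exponent `t` with `1/t + 1/q = 1/s`. -/
abbrev tExp : ℝ≥0∞ := ENNReal.ofReal (((P.q - P.η) / 2)⁻¹ - 2 * P.q⁻¹)⁻¹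

instance : Fact (1 ≤ P.sExp) := ⟨by
  have h1 := P.two_div_q_lt
  have h2 := P.inv_r_lt_one
  have h3 := P.inv_q_pos
  exact ENNReal.one_le_ofReal.2 ((one_le_inv₀ (by linarith)).2 (by linarith))⟩

instance : Fact (1 ≤ P.tExp) := ⟨by
  have h1 := P.two_div_q_lt
  have h2 := P.inv_r_lt_one
  have h3 := P.inv_q_pos
  exact ENNReal.one_le_ofReal.2 ((one_le_inv₀ (by linarith)).2 (by linarith))⟩

instance : ENNReal.HolderTriple P.qExp P.qExp P.qHalfExp :=
  have h := P.four_lt_q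
  holderTriple_ofReal (by linarith) (by linarith) (by linarith) (by rw [inv_div]; ring)

instance : ENNReal.HolderTriple P.qExp P.sExp P.rExp := by
  have h1 := P.two_div_q_lt
  have h3 := P.inv_q_pos
  exact holderTriple_ofReal (inv_pos.1 h3) (inv_pos.2 (by linarith))
    (by linarith [P.one_lt_r]) (by rw [inv_inv]; ring)

instance : ENNReal.HolderTriple P.tExp P.qExp P.sExp := by
  have h1 := P.two_div_q_lt
  have h3 := P.inv_q_pos
  exact holderTriple_ofReal (inv_pos.2 (by linarith)) (inv_pos.1 h3)
    (inv_pos.2 (by linarith)) (by rw [inv_inv, inv_inv]; ring)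

instance : ENNReal.HolderConjugate P.rExp P.rConjExp := by
  have h := P.one_lt_r
  have h1 : 0 < (P.q - P.η) / 2 - 1 := by linarith
  have := holderTriple_ofReal (a := (P.q - P.η) / 2) (b := (P.q - P.η) / 2 / ((P.q - P.η) / 2 - 1))
    (c := 1) (by linarith) (by positivity) one_pos
    (by rw [inv_div _ ((P.q - P.η) / 2 - 1), inv_one, ← one_div, ← add_div, add_sub_cancel,
      div_self (zero_lt_one.trans h).ne'])
  rwa [ENNReal.ofReal_one] at this

theorem sExp_le : P.sExp ≤ P.qExp := by
  have h1 := P.two_div_q_lt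
  have h3 := P.inv_q_pos
  exact ENNReal.ofReal_le_ofReal (inv_le_of_inv_le₀ (inv_pos.1 h3) (by linarith))

instance : Fact (P.rExp ≠ ⊤) := ⟨ENNReal.ofReal_ne_top⟩

end Exponents

/-! ### The divergence operator -/

section Divergence

variable {d : ℕ} {T : ℝ} {Ω : Set (Space d)}

/-- The Euclidean inner product as a bounded bilinear map. -/
def innerL (d : ℕ) : Space d →L[ℝ] Space d →L[ℝ] ℝ :=
  (InnerProductSpace.toDual ℝ (Space d)).toContinuousLinearEquiv.toContinuousLinearMap

theorem norm_innerL_sub (x y : Space d) : ‖innerL d x - innerL d y‖ = ‖x - y‖ := by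
  rw [← map_sub]
  exact (InnerProductSpace.toDual ℝ (Space d)).norm_map (x - y)

variable {r r' : ℝ≥0∞} [Fact (1 ≤ r)] [Fact (1 ≤ r')]
  {Z : Type*} [NormedAddCommGroup Z] [NormedSpace ℝ Z]

/-- `Λ ∈ L^r(0,T; Z*)` is the spatial divergence of the vector field `G`, for a normed space `Z` of
test functions with gradient `D : Z → L^{r'}(Ω; ℝ^d)`. -/
def IsDivergence (D : Z →L[ℝ] Lp (Space d) r' (domMeasure Ω)) (G : ℝ → Space d → Space d)
    (Λ : Lp (StrongDual ℝ Z) r (timeMeasure T)) : Prop :=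
  ∀ᵐ t ∂(timeMeasure T), ∀ φ : Z,
    Integrable (fun x => inner ℝ (G t x) (D φ x)) (domMeasure Ω) ∧
    Λ t φ = - ∫ x in Ω, inner ℝ (G t x) (D φ x)

variable [r.HolderConjugate r'] (D : Z →L[ℝ] Lp (Space d) r' (domMeasure Ω))

variable (r) in
/-- The divergence `L^r(Ω; ℝ^d) → Z*`. -/
def divDom : Lp (Space d) r (domMeasure Ω) →L[ℝ] StrongDual ℝ Z :=
  -((ContinuousLinearMap.precomp ℝ D).comp ((innerL d).lpPairing (domMeasure Ω) r r'))

theorem divDom_apply (g : Lp (Space d) r (domMeasure Ω)) (φ : Z) :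
    divDom r D g φ = - ∫ x in Ω, inner ℝ (g x) (D φ x) :=
  congrArg Neg.neg ((innerL d).lpPairing_eq_integral g (D φ))

variable [Fact (r ≠ ⊤)]

variable (T r) in
/-- The spatial divergence `L^r(Q_T; ℝ^d) → L^r(0,T; Z*)`. -/
def divCyl : Lp (Space d) r (cylMeasure T Ω) →L[ℝ] Lp (StrongDual ℝ Z) r (timeMeasure T) :=
  compSliceL Fact.out (divDom r D)

/-- By Fubini `g(t,·)` represents the slice of `G` for a.e. `t`. The exceptional set of times is
fixed before `φ`, so one null set serves all test functions. -/
theorem isDivergence_divCyl {G : Lp (Space d) r (cylMeasure T Ω)} {g : ℝ → Space d → Space d}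
    (hg : ∀ᵐ z ∂(cylMeasure T Ω), G z = g z.1 z.2) : IsDivergence D g (divCyl T r D G) := by
  filter_upwards [Measure.ae_ae_of_ae_prod hg,
    coeFn_compSliceL (μ := timeMeasure T) Fact.out (divDom r D) G] with t h1 ⟨f, h2, h3⟩ φ
  have h4 : (fun x => inner ℝ (g t x) (D φ x)) =ᵐ[domMeasure Ω]
      fun x => inner ℝ (f x) (D φ x) := by
    filter_upwards [h1, h2] with x h1 h2
    rw [h2, h1]
  refine ⟨Integrable.congr ?_ h4.symm, ?_⟩
  · exact memLp_one_iff_integrable.1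
      ((innerL d).memLp_of_bilin 1 (Lp.memLp f) (Lp.memLp (D φ)))
  · rw [integral_congr_ae h4, ← divDom_apply, ← h3]
    rfl

end Divergence

/-! ### Superposition with the Hamiltonian -/

section Superposition

variable {d : ℕ} {T : ℝ} {Ω : Set (Space d)}

theorem ae_snd_mem (hΩ : MeasurableSet Ω) : ∀ᵐ z ∂(cylMeasure T Ω), z.2 ∈ Ω :=
  Measure.quasiMeasurePreserving_snd.ae (ae_restrict_mem hΩ)

/-- Continuity is known only on `Ω × ℝ^d`, but the image of the cylinder measure under `(t,x) ↦ (x,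
g(t,x))` is carried by that set. -/
theorem aestronglyMeasurable_superposition {V : Type*} [TopologicalSpace V]
    [TopologicalSpace.PseudoMetrizableSpace V] {K : Space d → Space d → V}
    (hΩ : MeasurableSet Ω)
    (hK : ContinuousOn (fun z : Space d × Space d => K z.1 z.2) (Ω ×ˢ univ))
    {g : ℝ × Space d → Space d} (hg : AEStronglyMeasurable g (cylMeasure T Ω)) :
    AEStronglyMeasurable (fun z => K z.2 (g z)) (cylMeasure T Ω) := by
  have hm : AEMeasurable (fun z : ℝ × Space d => (z.2, g z)) (cylMeasure T Ω) :=
    measurable_snd.aemeasurable.prodMk hg.aemeasurable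
  have hS : MeasurableSet (Ω ×ˢ (univ : Set (Space d))) := hΩ.prod MeasurableSet.univ
  have h1 : AEStronglyMeasurable (fun z : Space d × Space d => K z.1 z.2)
      ((cylMeasure T Ω).map fun z => (z.2, g z)) := by
    rw [← Measure.restrict_eq_self_of_ae_mem
      (μ := (cylMeasure T Ω).map fun z => (z.2, g z)) (s := Ω ×ˢ univ)]
    · exact hK.aestronglyMeasurable hS
    · refine (ae_map_iff hm hS).2 ?_
      filter_upwards [ae_snd_mem hΩ] with z hz
      exact ⟨hz, mem_univ _⟩
  exact h1.comp_aemeasurable hm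

variable {H : Space d → Space d → ℝ}

theorem HamiltonianAssumption.hasFDerivAt (hH : HamiltonianAssumption Ω H) {x : Space d}
    (hx : x ∈ Ω) (p : Space d) : HasFDerivAt (H x) (innerL d (Hp H x p)) p :=
  (((hH.contDiff x hx).differentiable (by simp)) p).hasGradientAt.hasFDerivAt

theorem HamiltonianAssumption.hasStrictFDerivAt_Hp (hH : HamiltonianAssumption Ω H) {x : Space d}
    (hx : x ∈ Ω) (p : Space d) : HasStrictFDerivAt (Hp H x) (Hpp H x p) p := by
  have h1 : ContDiff ℝ 1 (fderiv ℝ (H x)) := (hH.contDiff x hx).fderiv_right (by norm_num)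
  have h2 : ContDiff ℝ 1 (Hp H x) :=
    (InnerProductSpace.toDual ℝ (Space d)).symm.toContinuousLinearEquiv.contDiff.comp h1
  exact h2.contDiffAt.hasStrictFDerivAt (by simp)

theorem HamiltonianAssumption.exists_lipschitz_Hp (hH : HamiltonianAssumption Ω H) :
    ∃ C : ℝ, ∀ x ∈ Ω, ∀ p p', ‖Hp H x p - Hp H x p'‖ ≤ C * ‖p - p'‖ := by
  obtain ⟨C, -, hC⟩ := hH.growth
  exact ⟨C, fun x hx p p' => convex_univ.norm_image_sub_le_of_norm_hasFDerivWithin_le (𝕜 := ℝ)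
    (fun e _ => (hH.hasStrictFDerivAt_Hp hx e).hasFDerivAt.hasFDerivWithinAt)
    (fun e _ => (hC x hx e).2.2) (mem_univ _) (mem_univ _)⟩

variable [IsFiniteMeasure (domMeasure Ω)] {q s : ℝ≥0∞}

theorem HamiltonianAssumption.memLp_H (hH : HamiltonianAssumption Ω H) (hΩ : MeasurableSet Ω)
    [q.HolderTriple q s] {g : ℝ × Space d → Space d} (hg : MemLp g q (cylMeasure T Ω)) :
    MemLp (fun z => H z.2 (g z)) s (cylMeasure T Ω) := by
  obtain ⟨C, hC0, hC⟩ := hH.growth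
  -- `|g|²` is written as a bilinear expression so that Hölder places it in `L^s`.
  have h1 : MemLp (fun z => inner ℝ (g z) (g z)) s (cylMeasure T Ω) :=
    (innerL d).memLp_of_bilin s hg hg
  refine (((memLp_const (1 : ℝ)).add h1).const_mul C).of_le
    (aestronglyMeasurable_superposition hΩ hH.cont_H hg.1) ?_
  filter_upwards [ae_snd_mem hΩ] with z hz
  refine ((hC z.2 hz (g z)).1).trans (le_of_eq ?_)
  simp only [Pi.add_apply, real_inner_self_eq_norm_sq]
  rw [Real.norm_of_nonneg (by positivity)]

theorem HamiltonianAssumption.memLp_Hp (hH : HamiltonianAssumption Ω H) (hΩ : MeasurableSet Ω)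
    {g : ℝ × Space d → Space d} (hg : MemLp g q (cylMeasure T Ω)) :
    MemLp (fun z => Hp H z.2 (g z)) q (cylMeasure T Ω) := by
  obtain ⟨C, hC0, hC⟩ := hH.growth
  refine (((memLp_const (1 : ℝ)).add hg.norm).const_mul C).of_le
    (aestronglyMeasurable_superposition hΩ hH.cont_Hp hg.1) ?_
  filter_upwards [ae_snd_mem hΩ] with z hz
  refine ((hC z.2 hz (g z)).2.1).trans (le_of_eq ?_)
  simp only [Pi.add_apply]
  rw [Real.norm_of_nonneg (by positivity)]

theorem HamiltonianAssumption.memLp_Hpp (hH : HamiltonianAssumption Ω H) (hΩ : MeasurableSet Ω)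
    {g : ℝ × Space d → Space d} (hg : AEStronglyMeasurable g (cylMeasure T Ω)) :
    MemLp (fun z => Hpp H z.2 (g z)) q (cylMeasure T Ω) := by
  obtain ⟨C, hC0, hC⟩ := hH.growth
  refine MemLp.of_bound (aestronglyMeasurable_superposition hΩ hH.cont_Hpp hg) C ?_
  filter_upwards [ae_snd_mem hΩ] with z hz
  exact (hC z.2 hz (g z)).2.2

/-- The derivative is multiplication by `H_p(·,g) ∈ L^q`, bounded into `L^s` by Hölder. The
Lipschitz criterion applies with no loss of exponent. -/
theorem HamiltonianAssumption.exists_nemytskii_H (hH : HamiltonianAssumption Ω H)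
    (hΩ : MeasurableSet Ω) [Fact (1 ≤ q)] [Fact (1 ≤ s)] [q.HolderTriple q s] :
    ∃ N : Lp (Space d) q (cylMeasure T Ω) → Lp ℝ s (cylMeasure T Ω),
      (∀ g, ∀ᵐ z ∂(cylMeasure T Ω), N g z = H z.2 (g z)) ∧
      ∀ g, ∃ A : Lp (Space d) q (cylMeasure T Ω) →L[ℝ] Lp ℝ s (cylMeasure T Ω),
        (∀ f, ∀ᵐ z ∂(cylMeasure T Ω), A f z = inner ℝ (Hp H z.2 (g z)) (f z)) ∧
        HasStrictFDerivAt N A g := by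
  have hN (g : Lp (Space d) q (cylMeasure T Ω)) :
      MemLp (fun z => H z.2 (g z)) s (cylMeasure T Ω) := hH.memLp_H hΩ (Lp.memLp g)
  refine ⟨fun g => (hN g).toLp, fun g => (hN g).coeFn_toLp, fun g => ?_⟩
  have hm := hH.memLp_Hp hΩ (Lp.memLp g)
  have hA (f : Lp (Space d) q (cylMeasure T Ω)) : ∀ᵐ z ∂(cylMeasure T Ω),
      (innerL d).holderL (cylMeasure T Ω) q q s (hm.toLp _) f z =
        innerL d (Hp H z.2 (g z)) (f z) := by
    filter_upwards [(innerL d).coeFn_holder (r := s) (hm.toLp _) f, hm.coeFn_toLp] with z h1 h2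
    rw [← h2]
    exact h1
  obtain ⟨C, hC⟩ := hH.exists_lipschitz_Hp
  refine ⟨_, hA, hasStrictFDerivAt_nemytskii_of_lipschitz (C := C) (k := fun z => H z.2)
    (k' := fun z e => innerL d (Hp H z.2 e)) (fun g => (hN g).coeFn_toLp) hA ?_ ?_⟩
  · filter_upwards [ae_snd_mem hΩ] with z hz e e'
    rw [norm_innerL_sub]
    exact hC z.2 hz e e'
  · filter_upwards [ae_snd_mem hΩ] with z hz e
    exact hH.hasFDerivAt hz e

/-- No modulus of continuity for `H_pp` is available, so the bounded criterion is used, at the price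
of a finite `t`. The multiplier `H_pp(·,g)` is bounded on a finite measure space, hence in `L^t`. -/
theorem HamiltonianAssumption.exists_nemytskii_Hp (hH : HamiltonianAssumption Ω H)
    (hΩ : MeasurableSet Ω) {t : ℝ≥0∞} [Fact (1 ≤ q)] [Fact (1 ≤ s)] [Fact (1 ≤ t)]
    [t.HolderTriple q s] (hsq : s ≤ q) (ht : t ≠ ⊤) :
    ∃ N : Lp (Space d) q (cylMeasure T Ω) → Lp (Space d) s (cylMeasure T Ω),
      (∀ g, ∀ᵐ z ∂(cylMeasure T Ω), N g z = Hp H z.2 (g z)) ∧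
      ∀ g, ∃ A : Lp (Space d) q (cylMeasure T Ω) →L[ℝ] Lp (Space d) s (cylMeasure T Ω),
        (∀ f, ∀ᵐ z ∂(cylMeasure T Ω), A f z = Hpp H z.2 (g z) (f z)) ∧
        HasStrictFDerivAt N A g := by
  have hN (g : Lp (Space d) q (cylMeasure T Ω)) :
      MemLp (fun z => Hp H z.2 (g z)) s (cylMeasure T Ω) :=
    (hH.memLp_Hp hΩ (Lp.memLp g)).mono_exponent hsq
  refine ⟨fun g => (hN g).toLp, fun g => (hN g).coeFn_toLp, fun g => ?_⟩
  have hm : MemLp (fun z => Hpp H z.2 (g z)) t (cylMeasure T Ω) :=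
    hH.memLp_Hpp hΩ (Lp.memLp g).1
  have hA (f : Lp (Space d) q (cylMeasure T Ω)) : ∀ᵐ z ∂(cylMeasure T Ω),
      (ContinuousLinearMap.id ℝ (Space d →L[ℝ] Space d)).holderL (cylMeasure T Ω) t q s
        (hm.toLp _) f z = Hpp H z.2 (g z) (f z) := by
    filter_upwards [(ContinuousLinearMap.id ℝ (Space d →L[ℝ] Space d)).coeFn_holder (r := s)
      (hm.toLp _) f, hm.coeFn_toLp] with z h1 h2
    rw [← h2]
    exact h1
  obtain ⟨C, -, hC⟩ := hH.growth
  refine ⟨_, hA, hasStrictFDerivAt_nemytskii_of_bounded (t := t) (C := C) Fact.out ht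
    (k := fun z => Hp H z.2) (k' := fun z => Hpp H z.2) (fun g => (hN g).coeFn_toLp) hA ?_ ?_⟩
  · filter_upwards [ae_snd_mem hΩ] with z hz e
    exact (hC z.2 hz e).2.2
  · filter_upwards [ae_snd_mem hΩ] with z hz e
    exact hH.hasStrictFDerivAt_Hp hz e

/-- Product rule for the bounded bilinear multiplication `L^q × L^s → L^r`, composed with the
previous operator. -/
theorem HamiltonianAssumption.exists_flux (hH : HamiltonianAssumption Ω H)
    (hΩ : MeasurableSet Ω) {t r : ℝ≥0∞} [Fact (1 ≤ q)] [Fact (1 ≤ s)] [Fact (1 ≤ t)]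
    [Fact (1 ≤ r)] [t.HolderTriple q s] [q.HolderTriple s r] (hsq : s ≤ q) (ht : t ≠ ⊤) :
    ∃ N : Lp (Space d) q (cylMeasure T Ω) × Lp ℝ q (cylMeasure T Ω) →
        Lp (Space d) r (cylMeasure T Ω),
      (∀ y, ∀ᵐ z ∂(cylMeasure T Ω), N y z = y.2 z • Hp H z.2 (y.1 z)) ∧
      ∀ y, ∃ A : Lp (Space d) q (cylMeasure T Ω) × Lp ℝ q (cylMeasure T Ω) →L[ℝ]
          Lp (Space d) r (cylMeasure T Ω),
        (∀ w, ∀ᵐ z ∂(cylMeasure T Ω), A w z =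
          w.2 z • Hp H z.2 (y.1 z) + y.2 z • Hpp H z.2 (y.1 z) (w.1 z)) ∧
        HasStrictFDerivAt N A y := by
  obtain ⟨N, hN, hdN⟩ := hH.exists_nemytskii_Hp (T := T) hΩ hsq ht
  let B := (ContinuousLinearMap.lsmul ℝ ℝ (E := Space d)).holderL (cylMeasure T Ω) q s r
  have hB (ρ : Lp ℝ q (cylMeasure T Ω)) (g : Lp (Space d) s (cylMeasure T Ω)) :
      ∀ᵐ z ∂(cylMeasure T Ω), B ρ g z = ρ z • g z :=
    (ContinuousLinearMap.lsmul ℝ ℝ).coeFn_holder ρ g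
  refine ⟨fun y => B y.2 (N y.1), fun y => ?_, fun y => ?_⟩
  · filter_upwards [hB y.2 (N y.1), hN y.1] with z h1 h2
    rw [h1, h2]
  obtain ⟨A, hA, hd⟩ := hdN y.1
  refine ⟨_, fun w => ?_, B.hasStrictFDerivAt_of_bilinear hasStrictFDerivAt_snd
    (hd.comp y hasStrictFDerivAt_fst)⟩
  filter_upwards [hA w.1, hN y.1, hB y.2 (A w.1), hB w.2 (N y.1),
    Lp.coeFn_add (B y.2 (A w.1)) (B w.2 (N y.1))] with z h1 h2 h3 h4 h5
  refine h5.trans ?_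
  rw [Pi.add_apply, h3, h4, h1, h2, add_comm]

end Superposition

/-! ### The nonlinear map -/

section NonlinearMap

variable {d : ℕ} {T : ℝ} {Ω : Set (Space d)} {H : Space d → Space d → ℝ}
  {F : Lp ℝ 2 (cylMeasure T Ω) → Lp ℝ 2 (cylMeasure T Ω)}

/-- `φ ↦ Dφ` on `W^{1,p}_0(Ω)`. -/
def gradW10 {d : ℕ} (Ω : Set (Space d)) (p : ℝ≥0∞) [Fact (1 ≤ p)] :
    W10 Ω p →L[ℝ] Lp (Space d) p (domMeasure Ω) :=
  (WithLp.sndL 1 ℝ _ _).comp (W10 Ω p).subtypeL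

/-- `v ↦ Dv` on `W^{0,1}_p(Q_T)`. -/
def gradW01 {d : ℕ} (T : ℝ) (Ω : Set (Space d)) (p : ℝ≥0∞) [Fact (1 ≤ p)] :
    W01 T Ω p →L[ℝ] Lp (Space d) p (cylMeasure T Ω) :=
  (WithLp.sndL 1 ℝ _ _).comp (W01 T Ω p).subtypeL

theorem coeFn_mapF {p r : ℝ≥0∞} {m : Lp ℝ p (cylMeasure T Ω)}
    (h : MemLp (applyF F m) r (cylMeasure T Ω)) : mapF F p r m =ᵐ[cylMeasure T Ω] applyF F m := by
  rw [mapF, recast, dif_pos h]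
  exact h.coeFn_toLp

theorem Exponents.contDiff_mapF (P : Exponents d) (hF : CouplingDifferentiable F) :
    (∀ m : Lp ℝ P.qExp (cylMeasure T Ω), MemLp (applyF F m) P.qHalfExp (cylMeasure T Ω)) ∧
      ContDiff ℝ 1 (mapF F P.qExp P.qHalfExp) :=
  have hq := P.four_lt_q
  hF P.qExp P.qHalfExp (ENNReal.one_lt_ofReal.2 (by linarith))
    ((ENNReal.ofReal_lt_ofReal_iff (by linarith)).2 (by linarith))
    (by rw [← ENNReal.ofReal_ofNat]; exact ENNReal.ofReal_le_ofReal (by linarith))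
    ENNReal.ofReal_lt_top

/-- The map `(v, ρ) ↦ (F[ρ] - H(·,Dv), div(ρ H_p(·,Dv)))` is well defined and strictly
differentiable, for abstract exponents with `1/q + 1/q = 1/q₂`, `1/q + 1/s = 1/r`,
`1/t + 1/q = 1/s` and `1/r + 1/r' = 1`. -/
theorem exists_strictly_differentiable_map [IsFiniteMeasure (domMeasure Ω)]
    (hΩ : MeasurableSet Ω) (hH : HamiltonianAssumption Ω H)
    {q q₂ r r' s t : ℝ≥0∞} [Fact (1 ≤ q)] [Fact (1 ≤ q₂)] [Fact (1 ≤ r)] [Fact (1 ≤ r')]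
    [Fact (1 ≤ s)] [Fact (1 ≤ t)] [q.HolderTriple q q₂] [t.HolderTriple q s] [q.HolderTriple s r]
    [r.HolderConjugate r'] [Fact (r ≠ ⊤)] (hsq : s ≤ q) (ht : t ≠ ⊤)
    (hFmem : ∀ m : Lp ℝ q (cylMeasure T Ω), MemLp (applyF F m) q₂ (cylMeasure T Ω))
    (hF : ContDiff ℝ 1 (mapF F q q₂))
    {Z Z' : Type*} [NormedAddCommGroup Z] [NormedSpace ℝ Z] [NormedAddCommGroup Z']
    [NormedSpace ℝ Z'] (D : Z →L[ℝ] Lp (Space d) q (cylMeasure T Ω))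
    (D' : Z' →L[ℝ] Lp (Space d) r' (domMeasure Ω)) :
    ∃ R : Z × Lp ℝ q (cylMeasure T Ω) →
        Lp ℝ q₂ (cylMeasure T Ω) × Lp (StrongDual ℝ Z') r (timeMeasure T),
      (∀ z, (∀ᵐ y ∂(cylMeasure T Ω), (R z).1 y = applyF F z.2 y - H y.2 (D z.1 y)) ∧
        IsDivergence D' (fun t x => z.2 (t, x) • Hp H x (D z.1 (t, x))) (R z).2) ∧
      ∀ a, ∃ dR : Z × Lp ℝ q (cylMeasure T Ω) →L[ℝ]
          Lp ℝ q₂ (cylMeasure T Ω) × Lp (StrongDual ℝ Z') r (timeMeasure T),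
        (∀ z, (∀ᵐ y ∂(cylMeasure T Ω), (dR z).1 y = fderiv ℝ (mapF F q q₂) a.2 z.2 y -
            inner ℝ (Hp H y.2 (D a.1 y)) (D z.1 y)) ∧
          IsDivergence D' (fun t x => z.2 (t, x) • Hp H x (D a.1 (t, x)) +
            a.2 (t, x) • Hpp H x (D a.1 (t, x)) (D z.1 (t, x))) (dR z).2) ∧
        HasStrictFDerivAt R dR a := by
  obtain ⟨N, hN, hdN⟩ := hH.exists_nemytskii_H (T := T) (q := q) (s := q₂) hΩ
  obtain ⟨V, hV, hdV⟩ := hH.exists_flux (T := T) (q := q) (s := s) (t := t) (r := r) hΩ hsq ht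
  let J : Z × Lp ℝ q (cylMeasure T Ω) →L[ℝ]
      Lp (Space d) q (cylMeasure T Ω) × Lp ℝ q (cylMeasure T Ω) :=
    D.prodMap (ContinuousLinearMap.id ℝ _)
  refine ⟨fun z => (mapF F q q₂ (J z).2 - N (J z).1, divCyl T r D' (V (J z))),
    fun z => ⟨?_, isDivergence_divCyl D' (hV (J z))⟩, fun a => ?_⟩
  · filter_upwards [coeFn_mapF (hFmem z.2), hN (J z).1, Lp.coeFn_sub
      (mapF F q q₂ (J z).2) (N (J z).1)] with y h1 h2 h3
    exact h3.trans (congrArg₂ (· - ·) h1 h2)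
  obtain ⟨A, hA, hdN⟩ := hdN (J a).1
  obtain ⟨A', hA', hdV⟩ := hdV (J a)
  have hdF : HasStrictFDerivAt (mapF F q q₂) (fderiv ℝ (mapF F q q₂) a.2) (J a).2 :=
    hF.contDiffAt.hasStrictFDerivAt one_ne_zero
  have h1 := (hdF.comp (J a) hasStrictFDerivAt_snd).sub (hdN.comp (J a) hasStrictFDerivAt_fst)
  have h2 := (divCyl T r D').hasStrictFDerivAt.comp (J a) hdV
  have h3 := (h1.prodMk h2).comp a J.hasStrictFDerivAt
  -- The derivative produced by the chain rule, written out so that its two components can be read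
  -- off by `rfl`.
  let dR := ((((fderiv ℝ (mapF F q q₂) a.2).comp (ContinuousLinearMap.snd ℝ _ _) -
    A.comp (ContinuousLinearMap.fst ℝ _ _)).prod ((divCyl T r D').comp A')).comp J)
  have e (z) : dR z = (fderiv ℝ (mapF F q q₂) a.2 z.2 - A (J z).1, divCyl T r D' (A' (J z))) := rfl
  refine ⟨dR, fun z => ?_, h3⟩
  rw [e z]
  refine ⟨?_, isDivergence_divCyl D' (hA' (J z))⟩
  filter_upwards [hA (J z).1, Lp.coeFn_sub
    (fderiv ℝ (mapF F q q₂) a.2 z.2) (A (J z).1)] with y h1 h2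
  exact h2.trans (congrArg (fderiv ℝ (mapF F q q₂) a.2 z.2 y - ·) h1)

end NonlinearMap

end MFG

end

open MFG in
theorem mainTheorem8 {d : ℕ} (hd : 1 ≤ d) (T : ℝ) (hT : 0 < T)
    (Ω : Set (MFG.Space d)) (hΩ_open : IsOpen Ω) (hΩ_conn : IsConnected Ω)
    (hΩ_bdd : Bornology.IsBounded Ω) (hΩ_cone : MFG.UniformConeConditions Ω)
    (P : MFG.Exponents d)
    (H : MFG.Space d → MFG.Space d → ℝ)
    (F : Lp ℝ 2 (MFG.cylMeasure T Ω) → Lp ℝ 2 (MFG.cylMeasure T Ω))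
    (m₀ uT : MFG.Space d → ℝ)
    (hData : MFG.DataAssumption T Ω H F m₀ uT)
    (hShift : MFG.ShiftProperty Ω P.q)
    (hF : MFG.CouplingDifferentiable F) :
    ∃ R₂ : MFG.X T Ω P → MFG.Y₂ T Ω P,
      (∀ z : MFG.X T Ω P, MFG.IsR₂Value H F z (R₂ z)) ∧
      ∀ a : MFG.X T Ω P, ∃ dR₂ : MFG.X T Ω P →L[ℝ] MFG.Y₂ T Ω P,
        (∀ z : MFG.X T Ω P, MFG.IsDR₂Value H F a z (dR₂ z)) ∧
        HasStrictFDerivAt R₂ dR₂ a := by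
  have hΩ : MeasurableSet Ω := hΩ_open.measurableSet
  have : IsFiniteMeasure (domMeasure Ω) := isFiniteMeasure_restrict.2 hΩ_bdd.measure_lt_top.ne
  have h := P.contDiff_mapF hF
  -- The predicates `IsR₂Value` and `IsDR₂Value` unfold to the abstract conclusion with `D` and `D'`
  -- the two gradient maps.
  exact exists_strictly_differentiable_map (s := P.sExp) (t := P.tExp) hΩ hData.hamiltonian
    P.sExp_le ENNReal.ofReal_ne_top h.1 h.2 (gradW01 T Ω P.qExp) (gradW10 Ω P.rConjExp)
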